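/- Let $T$ be a finite tree with adjacency matrix $A$, and let $\lambda\in\mathbb{R}$ be an eigenvalue of $A$. For an eigenvector $x$ of $A$ for $\lambda$ (so $x\neq 0$), let $N(T,x)$ be the set of vertices on which $x$ vanishes, and let $N^C(T,x)$ be the set of those vertices of $N(T,x)$ that are adjacent in $T$ to at least one connected component of $T\setminus N(T,x)$. Let $N_\lambda(T)$ be the set of vertices on which every eigenvector for $\lambda$ vanishes, and let $N^C_\lambda(T)=\bigcup_x N^C(T,x)$, the union being over all eigenvectors $x$ for $\lambda$. Let $C_1,\dots,C_r$ be the connected components of $T\setminus N_\lambda(T)$, and let $T/\{C_i\}_{i=1}^r$ be the graph obtained from $T$ by contracting each $C_i$ to a single vertex $c_i$. The skeleton $S_\lambda(T)$ is the subgraph of $T/\{C_i\}_{i=1}^r$ induced by the vertex set $N^C_\lambda(T)\cup\{c_1,\dots,c_r\}$. A maximum matching is a matching with the largest possible number of edges; it misses a vertex if none of its edges is incident to that vertex. Then: 1. The set of vertices of $S_\lambda(T)$ that are missed by at least one maximum matching of $S_\lambda(T)$ is exactly $\{c_1,\dots,c_r\}$. 2. For every maximum matching of $S_\lambda(T)$,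 the number of vertices of $S_\lambda(T)$ that it misses equals the multiplicity of $\lambda$ as an eigenvalue of $T$ (the dimension of the eigenspace). 3. If $y$ is a vector in the null space of the adjacency matrix of $S_\lambda(T)$ and $y_s\neq 0$ for a vertex $s$ of $S_\lambda(T)$, then $s\in\{c_1,\dots,c_r\}$. -/

import Mathlib

namespace TreeSkeleton

section Eigenvectors

variable {V : Type*} [Fintype V]

open Classical in
/-- The adjacency matrix of a finite graph, as an endomorphism of `V → ℝ`. -/
noncomputable def adjEnd (G : SimpleGraph V) : Module.End ℝ (V → ℝ) :=
  Matrix.toLin' (G.adjMatrix ℝ)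

/-- `lam` is an eigenvalue of the graph `G`. -/
def IsEigenvalue (G : SimpleGraph V) (lam : ℝ) : Prop :=
  (adjEnd G).HasEigenvalue lam

/-- `x` is an eigenvector (in particular nonzero) of `G` for `lam`. -/
def IsEigenvector (G : SimpleGraph V) (lam : ℝ) (x : V → ℝ) : Prop :=
  (adjEnd G).HasEigenvector lam x

/-- The multiplicity of `lam` as an eigenvalue of `G`: the dimension of its eigenspace. -/
noncomputable def multiplicity (G : SimpleGraph V) (lam : ℝ) : ℕ :=
  Module.finrank ℝ ((adjEnd G).eigenspace lam)

/-- The null space of (the adjacency matrix of) `G`. -/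
noncomputable def nullSpace (G : SimpleGraph V) : Submodule ℝ (V → ℝ) :=
  LinearMap.ker (adjEnd G)

end Eigenvectors

section Components

variable {V : Type*}

/-- The components of `G ∖ N`. -/
abbrev Comp (G : SimpleGraph V) (N : Set V) : Type _ :=
  (G.induce Nᶜ).ConnectedComponent

/-- The vertex set, in `G`, of a component of `G ∖ N`. -/
def compVerts (G : SimpleGraph V) (N : Set V) (C : Comp G N) : Set V :=
  Subtype.val '' C.supp

/-- The vertices of the contraction `G / {X i}`: one vertex for each `i`, and the vertices of `G`
that lie in no `X i`. -/
abbrev ContractVertex {ι : Type*} (X : ι → Set V) : Type _ :=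
  ι ⊕ {v : V // ∀ i, v ∉ X i}

/-- The vertices of `G` that a vertex of the contraction stands for. -/
def fibre {ι : Type*} (X : ι → Set V) : ContractVertex X → Set V
  | Sum.inl i => X i
  | Sum.inr v => {v.1}

/-- The contraction `G / {X i}` of mutually disjoint subgraphs with vertex sets `X i`. -/
def contract {ι : Type*} (G : SimpleGraph V) (X : ι → Set V) :
    SimpleGraph (ContractVertex X) where
  Adj a b := a ≠ b ∧ ∃ u ∈ fibre X a, ∃ v ∈ fibre X b, G.Adj u v
  symm := ⟨fun _ _ ⟨hne, u, hu, v, hv, h⟩ => ⟨hne.symm, v, hv, u, hu, h.symm⟩⟩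
  loopless := ⟨fun _ h => h.1 rfl⟩

end Components

section Skeleton

variable {V : Type*}

/-- `N(G, x)`: the vertices on which `x` vanishes. -/
def zeroSet (x : V → ℝ) : Set V := {v | x v = 0}

/-- `N^C(G, x)`: the vertices of `N(G, x)` adjacent to some component of `G ∖ N(G, x)`. -/
def adjZeroSet (G : SimpleGraph V) (x : V → ℝ) : Set V :=
  {v | v ∈ zeroSet x ∧ ∃ C : Comp G (zeroSet x), ∃ w ∈ compVerts G (zeroSet x) C, G.Adj v w}

variable [Fintype V]

/-- `N_lam(G)`: the vertices on which every eigenvector for `lam` vanishes. -/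
def eigZeroSet (G : SimpleGraph V) (lam : ℝ) : Set V :=
  {v | ∀ x, IsEigenvector G lam x → v ∈ zeroSet x}

/-- `N^C_lam(G)`: the union of the sets `N^C(G, x)` over the eigenvectors `x` for `lam`. -/
def eigAdjZeroSet (G : SimpleGraph V) (lam : ℝ) : Set V :=
  {v | ∃ x, IsEigenvector G lam x ∧ v ∈ adjZeroSet G x}

/-- The set of vertices of the skeleton, within the vertices of the contraction of all components
of `G ∖ N_lam(G)`: the contracted components and the vertices of `N^C_lam(G)`. -/
def skeletonVertexSet (G : SimpleGraph V) (lam : ℝ) :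
    Set (ContractVertex (compVerts G (eigZeroSet G lam))) :=
  Set.range Sum.inl ∪ {p | ∃ v, p = Sum.inr v ∧ v.1 ∈ eigAdjZeroSet G lam}

/-- The vertex type of the skeleton. -/
def SkeletonVertex (G : SimpleGraph V) (lam : ℝ) : Type _ :=
  ↥(skeletonVertexSet G lam)

instance (G : SimpleGraph V) (lam : ℝ) : Finite (SkeletonVertex G lam) := by
  unfold SkeletonVertex
  infer_instance

noncomputable instance (G : SimpleGraph V) (lam : ℝ) : Fintype (SkeletonVertex G lam) :=
  Fintype.ofFinite _

/-- The skeleton `S_lam(G)`: the subgraph that the skeleton vertices induce in the contraction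
of all components of `G ∖ N_lam(G)`. -/
def skeleton (G : SimpleGraph V) (lam : ℝ) : SimpleGraph (SkeletonVertex G lam) :=
  (contract G (compVerts G (eigZeroSet G lam))).induce (skeletonVertexSet G lam)

/-- The skeleton vertices that are contracted components of `G ∖ N_lam(G)`. -/
def contractedVertices (G : SimpleGraph V) (lam : ℝ) : Set (SkeletonVertex G lam) :=
  {s | ∃ C : Comp G (eigZeroSet G lam), s.1 = Sum.inl C}

end Skeleton

/-- A matching with the largest number of edges (for finite graphs). The vertices it misses are
those not in `M.verts`. -/
def IsMaximumMatching {W : Type*} {H : SimpleGraph W} (M : H.Subgraph) : Prop :=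
  M.IsMatching ∧ ∀ M' : H.Subgraph, M'.IsMatching → M'.edgeSet.ncard ≤ M.edgeSet.ncard

end TreeSkeleton

/-! Let `N` be `eigZeroSet`, let `K` be the components of `T ∖ N`, and let `A` be `boundary`. The
skeleton is bipartite between `K` and `A`. At `a ∈ A` the values of a generic eigenvector on the
neighbours sum to zero and are not all zero, so `a` has two neighbours outside `N`. Root `T`
anywhere outside `N`: one of the two is a child of `a`. Send `a` to the component of that child. Any
other boundary vertex adjacent to this component is deeper than `a`, so the incidence of `A` with
`K` is triangular, and the root's component is never used (`exists_child_choice`,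
`exists_component_choice`).

As the root can lie in any component, `A` can be matched into `K` minus any given element. Hence
maximum matchings cover `A`, miss `|K| - |A|` vertices, and can avoid any component. Triangularity
also makes null vectors vanish on `A`. Finally, eigenvectors are proportional along edges
(`eigenvector_mul_eq`), so each is a generic one rescaled on every component, subject to one
equation for each `a ∈ A`. These equations are independent by triangularity, so the multiplicity is
`|K| - |A|` too. -/

namespace TreeSkeleton

/-! ### Rooted trees: parents, descendants, flows. -/

section RootedTree

variable {V : Type*} {T : SimpleGraph V}

/-- In a tree rooted at `r`, a vertex has at most one neighbour that is closer to the root. -/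
lemma parent_unique (hT : T.IsTree) {r v p q : V} (hp : T.Adj p v) (hq : T.Adj q v)
    (hdp : T.dist r v = T.dist r p + 1) (hdq : T.dist r v = T.dist r q + 1) : p = q := by
  obtain ⟨P, hP⟩ := hT.connected.exists_walk_length_eq_dist r p
  obtain ⟨Q, hQ⟩ := hT.connected.exists_walk_length_eq_dist r q
  have hP' : (P.concat hp).IsPath :=
    SimpleGraph.Walk.isPath_of_length_eq_dist _ (by rw [SimpleGraph.Walk.length_concat, hP, hdp])
  have hQ' : (Q.concat hq).IsPath :=
    SimpleGraph.Walk.isPath_of_length_eq_dist _ (by rw [SimpleGraph.Walk.length_concat, hQ, hdq])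
  have h := (hT.existsUnique_path r v).unique hP' hQ'
  simpa using congrArg SimpleGraph.Walk.penultimate h

/-- If `w ∉ N` has its parent in `N`, then every vertex of its component of `T ∖ N` descends
from `w`. -/
lemma descends_of_reachable (hT : T.IsTree) {N : Set V} {r a : V} {w v : (Nᶜ : Set V)}
    (ha : a ∈ N) (haw : T.Adj a w) (hd : T.dist r w = T.dist r a + 1)
    (hwv : (T.induce Nᶜ).Reachable w v) :
    Relation.ReflTransGen (fun b c => T.Adj b c ∧ T.dist r b = T.dist r c + 1) (v : V) w := by
  rw [SimpleGraph.reachable_iff_reflTransGen] at hwv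
  induction hwv with
  | refl => exact .refl
  | @tail b c _ hbc ih =>
    have hbc' : T.Adj b c := hbc
    -- If `c` is the parent of `b`, then `b = w` would give `c = a ∈ N`; otherwise `c` is the next
    -- vertex on the chain up to `w`.
    rcases hT.dist_eq_dist_add_one_of_adj r hbc' with h | h
    · rcases Relation.ReflTransGen.cases_head ih with h0 | ⟨u, ⟨hbu, hdu⟩, hu⟩
      · rw [← h0] at haw hd
        exact absurd ha (parent_unique hT haw hbc'.symm hd h ▸ c.2)
      · rwa [parent_unique hT hbc'.symm hbu.symm h hdu]
    · exact .head ⟨hbc'.symm, h⟩ ih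

lemma dist_le_of_descends {r v w : V}
    (h : Relation.ReflTransGen (fun b c => T.Adj b c ∧ T.dist r b = T.dist r c + 1) v w) :
    v = w ∨ T.dist r w < T.dist r v := by
  induction h using Relation.ReflTransGen.head_induction_on with
  | refl => exact .inl rfl
  | head hbc _ ih =>
    obtain ⟨_, hd⟩ := hbc
    rcases ih with rfl | ih
    · right; omega
    · right; omega

/-- A choice of a child outside `N` for each vertex of `A ⊆ N`, in the tree `T` rooted outside
`N`. A vertex of `N` that is adjacent to the component of the child of `a` is `a` itself or lies
deeper than `a`. -/
lemma exists_child_choice (hT : T.IsTree) {N A : Set V} (r : (Nᶜ : Set V)) (hAN : A ⊆ N)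
    (hA : ∀ a ∈ A, ∃ w₁ ∉ N, ∃ w₂ ∉ N, w₁ ≠ w₂ ∧ T.Adj a w₁ ∧ T.Adj a w₂) :
    ∃ child : A → (Nᶜ : Set V), ∀ a : A, T.Adj a (child a) ∧
      ¬ (T.induce Nᶜ).Reachable (child a) r ∧
      ∀ a' ∈ N, ∀ v, (T.induce Nᶜ).Reachable (child a) v → T.Adj a' v →
        (a' = a ∧ v = child a) ∨ T.dist r a < T.dist r a' := by
  have key : ∀ a : A, ∃ w : (Nᶜ : Set V), T.Adj a w ∧ T.dist r w = T.dist r a + 1 := by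
    rintro ⟨a, ha⟩
    obtain ⟨w₁, h₁, w₂, h₂, hne, ha₁, ha₂⟩ := hA a ha
    rcases hT.dist_eq_dist_add_one_of_adj r ha₁ with h | h
    · rcases hT.dist_eq_dist_add_one_of_adj r ha₂ with h' | h'
      · exact absurd (parent_unique hT ha₁.symm ha₂.symm h h') hne
      · exact ⟨⟨w₂, h₂⟩, ha₂, h'⟩
    · exact ⟨⟨w₁, h₁⟩, ha₁, h⟩
  choose child hadj hdist using key
  refine ⟨child, fun a => ⟨hadj a, fun hr => ?_, fun a' ha' v hv hav => ?_⟩⟩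
  · have h := dist_le_of_descends
      (descends_of_reachable hT (hAN a.2) (hadj a) (hdist a) hr)
    have := hdist a
    rcases h with h | h
    · rw [← h, SimpleGraph.dist_self] at this; omega
    · rw [SimpleGraph.dist_self] at h; omega
  · have h := dist_le_of_descends
      (descends_of_reachable hT (hAN a.2) (hadj a) (hdist a) hv)
    have hda := hdist a
    rcases hT.dist_eq_dist_add_one_of_adj r hav with h' | h'
    · right
      rcases h with h | h
      · rw [h] at h'; omega
      · omega
    · left
      -- `a'` is the parent of `v`, so `child a` descends from `v` as well as conversely.
      have h2 := dist_le_of_descends (descends_of_reachable hT ha' hav h' hv.symm)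
      have hvw : v = child a := by
        rcases h with h | h
        · exact Subtype.ext h
        · rcases h2 with h2 | h2
          · exact (Subtype.ext h2).symm
          · omega
      refine ⟨?_, hvw⟩
      rw [hvw] at hav h'
      exact parent_unique hT hav (hadj a) h' hda

/-- An antisymmetric function on the edges of a finite tree without divergence vanishes. -/
lemma eq_zero_of_divergence_eq_zero [Fintype V] [DecidableRel T.Adj] (hT : T.IsTree)
    (f : V → V → ℝ) (hanti : ∀ v w, f v w = - f w v)
    (hdiv : ∀ v, ∑ w ∈ T.neighborFinset v, f v w = 0) {v w : V} (hvw : T.Adj v w) :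
    f v w = 0 := by
  classical
  let r := v
  -- Induction from the deepest vertices upwards: once the edges to the children of `v` carry zero,
  -- so does the edge to its parent.
  have key : ∀ n, ∀ v p, T.Adj v p → T.dist r v = T.dist r p + 1 →
      Fintype.card V - T.dist r v = n → f v p = 0 := by
    intro n
    induction n using Nat.strong_induction_on with
    | _ n ih =>
      intro v p hvp hd hn
      rw [← hdiv v]
      symm
      refine Finset.sum_eq_single_of_mem p (by simpa using hvp) fun c hc hcp => ?_
      have hvc : T.Adj v c := by simpa using hc
      rcases hT.dist_eq_dist_add_one_of_adj r hvc with h | h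
      · exact absurd (parent_unique hT hvc.symm hvp.symm h hd) hcp
      · have hlt : T.dist r c < Fintype.card V := by
          obtain ⟨P, hP, hl⟩ := hT.connected.exists_path_of_dist r c
          rw [← hl]; exact hP.length_lt
        rw [hanti, ih _ (by omega) c v hvc.symm h rfl, neg_zero]
  rcases hT.dist_eq_dist_add_one_of_adj r hvw with h | h
  · exact key _ v w hvw h rfl
  · rw [hanti, key _ w v hvw.symm h rfl, neg_zero]

end RootedTree

/-! ### Matchings and independent sets. -/

section Matching

variable {W : Type*} {H : SimpleGraph W}

lemma exists_isMatching_of_injective {K : Set W} (κ : (Kᶜ : Set W) → K)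
    (hinj : Function.Injective κ) (hadj : ∀ a : (Kᶜ : Set W), H.Adj a (κ a)) :
    ∃ M : H.Subgraph, M.IsMatching ∧ M.verts = Kᶜ ∪ Set.range (fun a => (κ a : W)) := by
  have hinj' : Function.Injective (fun a => (κ a : W)) := Subtype.val_injective.comp hinj
  obtain ⟨M, hv, hM⟩ := SimpleGraph.Subgraph.IsMatching.exists_of_disjoint_sets_of_equiv
    (G := H) (s := Kᶜ) (t := Set.range (fun a => (κ a : W)))
    (Set.disjoint_left.mpr (by rintro x hx ⟨a, rfl⟩; exact hx (κ a).2))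
    (Equiv.ofInjective _ hinj') (fun a => hadj a)
  exact ⟨M, hM, hv⟩

variable [Finite W]

lemma ncard_verts_of_isMatching {M : H.Subgraph} (hM : M.IsMatching) :
    M.verts.ncard = 2 * M.edgeSet.ncard := by
  classical
  have := Fintype.ofFinite W
  have h := M.spanningCoe.sum_degrees_eq_twice_card_edges
  have hdeg : ∀ v, M.spanningCoe.degree v = if v ∈ M.verts then 1 else 0 := by
    intro v
    rw [SimpleGraph.Subgraph.degree_spanningCoe]
    split_ifs with hv
    · exact SimpleGraph.Subgraph.isMatching_iff_forall_degree.mp hM v hv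
    · exact M.degree_of_notMem_verts hv
  rw [Finset.sum_congr rfl fun v _ => hdeg v, Finset.sum_boole, Nat.cast_id] at h
  rw [← M.edgeSet_spanningCoe, ← SimpleGraph.coe_edgeFinset M.spanningCoe, Set.ncard_coe_finset,
    ← h, ← Set.ncard_coe_finset]
  simp

/-- If `K` is independent, a matching has at most as many edges as `K` has non-members, and it
covers all of these when there is equality. -/
lemma edgeSet_ncard_le_of_isMatching {K : Set W} (hK : ∀ c ∈ K, ∀ c' ∈ K, ¬ H.Adj c c')
    {M : H.Subgraph} (hM : M.IsMatching) :
    M.edgeSet.ncard ≤ Kᶜ.ncard ∧ (M.edgeSet.ncard = Kᶜ.ncard → Kᶜ ⊆ M.verts) := by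
  have key : ∀ e : M.edgeSet, ∃ a ∈ Kᶜ, a ∈ e.1 := by
    rintro ⟨e, he⟩
    induction e using Sym2.ind with
    | _ u v =>
      have huv : M.Adj u v := he
      by_cases hu : u ∈ K
      · exact ⟨v, fun hv => hK u hu v hv huv.adj_sub, by simp⟩
      · exact ⟨u, hu, by simp⟩
  choose g hgK hge using key
  have hinj : Function.Injective g := by
    rintro ⟨e, he⟩ ⟨e', he'⟩ hg
    have h1 := hge ⟨e, he⟩
    have h2 := hge ⟨e', he'⟩
    rw [← hg] at h2
    obtain ⟨u, hu⟩ := h1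
    obtain ⟨v, hv⟩ := h2
    simp only at hu hv
    apply Subtype.ext
    change e = e'
    rw [hu] at he ⊢
    rw [hv] at he' ⊢
    have huv : u = v := hM.eq_of_adj_left he he'
    rw [huv]
  have hmem : ∀ e, g e ∈ M.verts := fun e => SimpleGraph.Subgraph.mem_verts_of_mem_edge e.2 (hge e)
  have hcard : (Set.range g).ncard = M.edgeSet.ncard := by
    rw [← Set.image_univ, Set.ncard_image_of_injective _ hinj, Set.ncard_univ, Nat.card_coe_set_eq]
  have hsub : Set.range g ⊆ Kᶜ := by rintro _ ⟨e, rfl⟩; exact hgK e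
  refine ⟨hcard ▸ Set.ncard_le_ncard hsub (Set.toFinite _), fun h => ?_⟩
  rw [← Set.eq_of_subset_of_ncard_le hsub (by rw [hcard, h]) (Set.toFinite _)]
  rintro _ ⟨e, rfl⟩; exact hmem e

lemma edgeSet_ncard_of_verts_eq {K : Set W} {κ : (Kᶜ : Set W) → K}
    (hinj : Function.Injective κ) {M : H.Subgraph} (hM : M.IsMatching)
    (hv : M.verts = Kᶜ ∪ Set.range (fun a => (κ a : W))) : M.edgeSet.ncard = Kᶜ.ncard := by
  have hinj' : Function.Injective (fun a => (κ a : W)) := Subtype.val_injective.comp hinj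
  have h := ncard_verts_of_isMatching hM
  rw [hv, Set.ncard_union_eq
    (Set.disjoint_left.mpr (by rintro x hx ⟨a, rfl⟩; exact hx (κ a).2)),
    ← Set.image_univ, Set.ncard_image_of_injective _ hinj', Set.ncard_univ,
    Nat.card_coe_set_eq] at h
  omega

/-- Suppose that `K` is independent and that the complement of `K` can be matched into `K`. Then
the maximum matchings cover the complement of `K`. -/
lemma compl_subset_verts_of_isMaximumMatching {K : Set W}
    (hK : ∀ c ∈ K, ∀ c' ∈ K, ¬ H.Adj c c') {κ : (Kᶜ : Set W) → K}
    (hinj : Function.Injective κ) (hadj : ∀ a : (Kᶜ : Set W), H.Adj a (κ a))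
    {M : H.Subgraph} (hM : IsMaximumMatching M) :
    Kᶜ ⊆ M.verts ∧ {s | s ∉ M.verts}.ncard + Kᶜ.ncard = K.ncard := by
  obtain ⟨M₀, hM₀, hv⟩ := exists_isMatching_of_injective κ hinj hadj
  have h₀ := edgeSet_ncard_of_verts_eq hinj hM₀ hv
  obtain ⟨hle, hcov⟩ := edgeSet_ncard_le_of_isMatching hK hM.1
  -- `M₀` attains the upper bound, so every maximum matching does.
  have heq : M.edgeSet.ncard = Kᶜ.ncard := le_antisymm hle (h₀ ▸ hM.2 M₀ hM₀)
  refine ⟨hcov heq, ?_⟩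
  have h1 := ncard_verts_of_isMatching hM.1
  have h2 := Set.ncard_add_ncard_compl M.verts
  have h3 := Set.ncard_add_ncard_compl K
  change M.vertsᶜ.ncard + _ = _
  omega

/-- Suppose that `K` is independent and that for each `c ∈ K` the complement of `K` can be matched
into `K ∖ {c}`. Then `K` is the set of the vertices missed by some maximum matching. -/
lemma missed_eq_of_forall_exists {K : Set W} (hne : K.Nonempty)
    (hK : ∀ c ∈ K, ∀ c' ∈ K, ¬ H.Adj c c')
    (h : ∀ c : K, ∃ κ : (Kᶜ : Set W) → K, Function.Injective κ ∧
      (∀ a : (Kᶜ : Set W), H.Adj a (κ a)) ∧ ∀ a, κ a ≠ c) :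
    {s | ∃ M : H.Subgraph, IsMaximumMatching M ∧ s ∉ M.verts} = K := by
  ext s
  constructor
  · rintro ⟨M, hM, hs⟩
    obtain ⟨c, hc⟩ := hne
    obtain ⟨κ, hinj, hadj, -⟩ := h ⟨c, hc⟩
    by_contra hsK
    exact hs ((compl_subset_verts_of_isMaximumMatching hK hinj hadj hM).1 hsK)
  · intro hs
    obtain ⟨κ, hinj, hadj, hmiss⟩ := h ⟨s, hs⟩
    obtain ⟨M, hM, hv⟩ := exists_isMatching_of_injective κ hinj hadj
    refine ⟨M, ⟨hM, fun M' hM' => ?_⟩, ?_⟩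
    · rw [edgeSet_ncard_of_verts_eq hinj hM hv]
      exact (edgeSet_ncard_le_of_isMatching hK hM').1
    · rw [hv]
      rintro (hs' | ⟨a, ha⟩)
      · exact hs' hs
      · exact hmiss a (Subtype.ext ha)

end Matching

/-- A matrix that is triangular with respect to a choice of a column for each row has independent
rows. -/
lemma eq_zero_of_vecMul_eq_zero {A C : Type*} [Fintype A] (B : A → C → ℝ)
    (κ : A → C) (d : A → ℕ) (hdiag : ∀ a, B a (κ a) ≠ 0)
    (htri : ∀ a a', B a' (κ a) ≠ 0 → a' = a ∨ d a < d a') (u : A → ℝ)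
    (hu : ∀ a, ∑ a', u a' * B a' (κ a) = 0) : u = 0 := by
  classical
  by_contra hne
  obtain ⟨a₀, ha₀⟩ := Function.ne_iff.mp hne
  -- In column `κ a`, the other nonzero entries lie in rows of larger `d`, where `u` vanishes by
  -- maximality.
  obtain ⟨a, ha, hmax⟩ := (Finset.univ.filter fun a => u a ≠ 0).exists_max_image d
    ⟨a₀, by simpa using ha₀⟩
  have h := hu a
  rw [Finset.sum_eq_single_of_mem a (Finset.mem_univ a)] at h
  · exact (mul_ne_zero (by simpa using ha) (hdiag a)) h
  · intro a' _ hne'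
    by_cases hB : B a' (κ a) = 0
    · rw [hB, mul_zero]
    · rcases htri a a' hB with h' | h'
      · exact absurd h' hne'
      · by_cases hua : u a' = 0
        · rw [hua, zero_mul]
        · exact absurd (hmax a' (by simpa using hua)) (by omega)

/-! ### The eigenspace as scalings of a generic eigenvector. -/

section Eigenspace

variable {V : Type*} [Fintype V] {T : SimpleGraph V} {lam : ℝ}

open Classical in
lemma adjEnd_apply (G : SimpleGraph V) (x : V → ℝ) (v : V) :
    adjEnd G x v = ∑ w ∈ G.neighborFinset v, x w := by
  rw [adjEnd, Matrix.toLin'_apply, SimpleGraph.adjMatrix_mulVec_apply]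

lemma mem_eigenspace_iff {G : SimpleGraph V} {x : V → ℝ} :
    x ∈ (adjEnd G).eigenspace lam ↔ ∀ v, adjEnd G x v = lam * x v := by
  rw [Module.End.mem_eigenspace_iff, funext_iff]
  rfl

lemma apply_eq_zero_of_mem_eigZeroSet {x : V → ℝ} (hx : x ∈ (adjEnd T).eigenspace lam) {v : V}
    (hv : v ∈ eigZeroSet T lam) : x v = 0 := by
  by_cases h0 : x = 0
  · rw [h0]; rfl
  · exact hv x ⟨hx, h0⟩

/-- Some vector of the eigenspace vanishes exactly on `eigZeroSet`. -/
lemma exists_generic_eigenvector (T : SimpleGraph V) (lam : ℝ) :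
    ∃ x ∈ (adjEnd T).eigenspace lam, ∀ v, x v = 0 ↔ v ∈ eigZeroSet T lam := by
  classical
  let E := (adjEnd T).eigenspace lam
  let p : V → Subspace ℝ E := fun v => LinearMap.ker ((LinearMap.proj v).comp E.subtype)
  let s : Finset (Subspace ℝ E) := (Finset.univ.filter fun v => v ∉ eigZeroSet T lam).image p
  have hs : ⊤ ∉ s := by
    intro h
    obtain ⟨v, hv, hp⟩ := Finset.mem_image.mp h
    refine (Finset.mem_filter.mp hv).2 fun x hx => ?_
    have hmem : (⟨x, hx.1⟩ : E) ∈ p v := hp ▸ Submodule.mem_top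
    exact hmem
  -- A real vector space is not a finite union of proper subspaces.
  obtain ⟨x, hx⟩ := (Set.ne_univ_iff_exists_notMem _).mp (Subspace.biUnion_ne_univ_of_top_notMem hs)
  refine ⟨x, x.2, fun v => ⟨fun h0 => ?_, apply_eq_zero_of_mem_eigZeroSet x.2⟩⟩
  by_contra hv
  refine hx (Set.mem_iUnion₂.mpr ⟨p v, Finset.mem_image_of_mem p (by simpa using hv), h0⟩)

lemma exists_notMem_eigZeroSet (hlam : IsEigenvalue T lam) : ∃ v, v ∉ eigZeroSet T lam := by
  obtain ⟨x, hx⟩ := Module.End.HasEigenvalue.exists_hasEigenvector hlam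
  obtain ⟨v, hv⟩ := Function.ne_iff.mp hx.2
  exact ⟨v, fun h => hv (h x hx)⟩

/-- Two eigenvectors of a tree for the same eigenvalue are proportional along each edge. -/
lemma eigenvector_mul_eq (hT : T.IsTree) {x y : V → ℝ} (hx : x ∈ (adjEnd T).eigenspace lam)
    (hy : y ∈ (adjEnd T).eigenspace lam) {v w : V} (hvw : T.Adj v w) :
    x v * y w = x w * y v := by
  classical
  -- This flow has divergence `x v * (lam * y v) - (lam * x v) * y v = 0` at `v`.
  refine sub_eq_zero.mp (eq_zero_of_divergence_eq_zero hT (fun v w => x v * y w - x w * y v)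
    (fun v w => by ring) (fun v => ?_) hvw)
  rw [Finset.sum_sub_distrib, ← Finset.mul_sum, ← Finset.sum_mul]
  have h1 := mem_eigenspace_iff.mp hx v
  have h2 := mem_eigenspace_iff.mp hy v
  rw [adjEnd_apply] at h1 h2
  convert_to x v * (lam * y v) - (lam * x v) * y v = 0
  · rw [← h1, ← h2]
  · ring

lemma div_eq_of_reachable (hT : T.IsTree) {x y : V → ℝ} (hx : x ∈ (adjEnd T).eigenspace lam)
    (hx0 : ∀ v, x v = 0 ↔ v ∈ eigZeroSet T lam)
    (hy : y ∈ (adjEnd T).eigenspace lam) {v w : ((eigZeroSet T lam)ᶜ : Set V)}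
    (h : (T.induce (eigZeroSet T lam)ᶜ).Reachable v w) : y v / x v = y w / x w := by
  rw [SimpleGraph.reachable_iff_reflTransGen] at h
  induction h with
  | refl => rfl
  | @tail b c _ hbc ih =>
    rw [ih, div_eq_div_iff (fun h => b.2 ((hx0 _).mp h)) (fun h => c.2 ((hx0 _).mp h))]
    have := eigenvector_mul_eq hT hx hy (show T.Adj b c from hbc)
    linarith

/-- The vertices of `eigZeroSet` with a neighbour outside it. -/
def boundary (T : SimpleGraph V) (lam : ℝ) : Set V :=
  {v | v ∈ eigZeroSet T lam ∧ ∃ w, w ∉ eigZeroSet T lam ∧ T.Adj v w}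

/-- A single nonzero term could not cancel in the eigenvalue equation of a generic eigenvector at
`a`. -/
lemma two_neighbors_of_mem_boundary {a : V} (ha : a ∈ boundary T lam) :
    ∃ w₁ ∉ eigZeroSet T lam, ∃ w₂ ∉ eigZeroSet T lam, w₁ ≠ w₂ ∧ T.Adj a w₁ ∧ T.Adj a w₂ := by
  classical
  obtain ⟨x, hx, hx0⟩ := exists_generic_eigenvector T lam
  obtain ⟨haN, w, hw, haw⟩ := ha
  by_contra! hcon
  have h := mem_eigenspace_iff.mp hx a
  rw [adjEnd_apply, (hx0 a).mpr haN, mul_zero,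
    Finset.sum_eq_single_of_mem w (by simpa using haw)] at h
  · exact hw ((hx0 w).mp h)
  · intro w' hw' hne
    by_contra hw0
    exact hcon w hw w' (fun h => hw0 ((hx0 w').mpr h)) hne.symm haw (by simpa using hw')

lemma exists_boundary_choice (hT : T.IsTree) (r : ((eigZeroSet T lam)ᶜ : Set V)) :
    ∃ child : boundary T lam → ((eigZeroSet T lam)ᶜ : Set V), ∀ a : boundary T lam,
      T.Adj a (child a) ∧
      ¬ (T.induce (eigZeroSet T lam)ᶜ).Reachable (child a) r ∧
      ∀ a' ∈ eigZeroSet T lam, ∀ v, (T.induce (eigZeroSet T lam)ᶜ).Reachable (child a) v →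
        T.Adj a' v → (a' = a ∧ v = child a) ∨ T.dist r a < T.dist r a' :=
  exists_child_choice hT r (fun _ ha => ha.1) fun _ ha => two_neighbors_of_mem_boundary ha

open Classical in
/-- The vector that is `α C` times `x` on each component `C` and vanishes on `eigZeroSet`. -/
noncomputable def scaleOnComp (T : SimpleGraph V) (lam : ℝ) (x : V → ℝ) :
    (Comp T (eigZeroSet T lam) → ℝ) →ₗ[ℝ] (V → ℝ) where
  toFun α v := if h : v ∈ eigZeroSet T lam then 0
    else α ((T.induce (eigZeroSet T lam)ᶜ).connectedComponentMk ⟨v, h⟩) * x v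
  map_add' α β := by
    ext v
    by_cases h : v ∈ eigZeroSet T lam <;> simp [h, add_mul]
  map_smul' t α := by
    ext v
    by_cases h : v ∈ eigZeroSet T lam <;> simp [h, mul_assoc]

lemma scaleOnComp_of_mem (x : V → ℝ) (α : Comp T (eigZeroSet T lam) → ℝ) {v : V}
    (h : v ∈ eigZeroSet T lam) : scaleOnComp T lam x α v = 0 :=
  dif_pos h

lemma scaleOnComp_of_notMem (x : V → ℝ) (α : Comp T (eigZeroSet T lam) → ℝ)
    (v : ((eigZeroSet T lam)ᶜ : Set V)) :
    scaleOnComp T lam x α v =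
      α ((T.induce (eigZeroSet T lam)ᶜ).connectedComponentMk v) * x v :=
  dif_neg v.2

lemma scaleOnComp_injective {x : V → ℝ} (hx0 : ∀ v, x v = 0 ↔ v ∈ eigZeroSet T lam) :
    Function.Injective (scaleOnComp T lam x) := by
  intro α β h
  ext C
  induction C using SimpleGraph.ConnectedComponent.ind with
  | _ v =>
    have hv := congrFun h v
    rw [scaleOnComp_of_notMem, scaleOnComp_of_notMem] at hv
    exact mul_right_cancel₀ (fun h => v.2 ((hx0 _).mp h)) hv

/-- The defect of the eigenvalue equation on the boundary, for the vectors `scaleOnComp`. -/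
noncomputable def boundaryMap (T : SimpleGraph V) (lam : ℝ) (x : V → ℝ) :
    (Comp T (eigZeroSet T lam) → ℝ) →ₗ[ℝ] (boundary T lam → ℝ) :=
  (LinearMap.funLeft ℝ ℝ (Subtype.val : boundary T lam → V)).comp
    ((adjEnd T).comp (scaleOnComp T lam x))

lemma boundaryMap_apply (x : V → ℝ) (α : Comp T (eigZeroSet T lam) → ℝ) (a : boundary T lam) :
    boundaryMap T lam x α a = adjEnd T (scaleOnComp T lam x α) a :=
  rfl

/-- The eigenspace is the image of the kernel of `boundaryMap`. -/
lemma map_ker_boundaryMap (hT : T.IsTree) {x : V → ℝ} (hx : x ∈ (adjEnd T).eigenspace lam)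
    (hx0 : ∀ v, x v = 0 ↔ v ∈ eigZeroSet T lam) :
    (LinearMap.ker (boundaryMap T lam x)).map (scaleOnComp T lam x) =
      (adjEnd T).eigenspace lam := by
  classical
  apply le_antisymm
  · rintro _ ⟨α, hα, rfl⟩
    rw [mem_eigenspace_iff]
    intro v
    -- On the boundary the equation is the kernel condition; elsewhere in `eigZeroSet` all terms
    -- vanish; outside it, the neighbours that contribute share the component of `v`, so the
    -- equation of `x` is just rescaled.
    by_cases hv : v ∈ eigZeroSet T lam
    · rw [scaleOnComp_of_mem x α hv, mul_zero]
      by_cases hvb : v ∈ boundary T lam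
      · exact congrFun (LinearMap.mem_ker.mp hα) ⟨v, hvb⟩
      · rw [adjEnd_apply]
        refine Finset.sum_eq_zero fun w hw => scaleOnComp_of_mem x α ?_
        by_contra hwN
        exact hvb ⟨hv, w, hwN, by simpa using hw⟩
    · have hsc := scaleOnComp_of_notMem x α ⟨v, hv⟩
      have hxv := mem_eigenspace_iff.mp hx v
      simp only at hsc
      rw [hsc, mul_left_comm, ← hxv, adjEnd_apply, adjEnd_apply, Finset.mul_sum]
      refine Finset.sum_congr rfl fun w hw => ?_
      by_cases hwN : w ∈ eigZeroSet T lam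
      · rw [scaleOnComp_of_mem x α hwN, (hx0 w).mpr hwN, mul_zero]
      · have hsw := scaleOnComp_of_notMem x α ⟨w, hwN⟩
        simp only at hsw
        rw [hsw]
        congr 2
        have hadj : (T.induce (eigZeroSet T lam)ᶜ).Adj ⟨w, hwN⟩ ⟨v, hv⟩ := by
          have : T.Adj v w := by simpa using hw
          exact this.symm
        exact SimpleGraph.ConnectedComponent.sound hadj.reachable
  · intro y hy
    let α : Comp T (eigZeroSet T lam) → ℝ := fun C =>
      SimpleGraph.ConnectedComponent.lift
        (fun v : ((eigZeroSet T lam)ᶜ : Set V) => y v / x v) (fun v w p _ => div_eq_of_reachable hT hx hx0 hy p.reachable) C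
    have hα : scaleOnComp T lam x α = y := by
      ext v
      by_cases hv : v ∈ eigZeroSet T lam
      · rw [scaleOnComp_of_mem x α hv, apply_eq_zero_of_mem_eigZeroSet hy hv]
      · have hsc := scaleOnComp_of_notMem x α ⟨v, hv⟩
        simp only at hsc
        rw [hsc]
        exact div_mul_cancel₀ _ (fun h => hv ((hx0 _).mp h))
    refine ⟨α, LinearMap.mem_ker.mpr ?_, hα⟩
    ext a
    rw [boundaryMap_apply, hα, mem_eigenspace_iff.mp hy, apply_eq_zero_of_mem_eigZeroSet hy a.2.1,
      mul_zero, Pi.zero_apply]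

/-- The matrix has independent rows by triangularity. Its diagonal entry at `a` is `x (child a) ≠
0`, since `child a` is the only neighbour of `a` in its component. -/
lemma boundaryMap_surjective (hT : T.IsTree) (hlam : IsEigenvalue T lam) {x : V → ℝ}
    (hx0 : ∀ v, x v = 0 ↔ v ∈ eigZeroSet T lam) :
    Function.Surjective (boundaryMap T lam x) := by
  classical
  obtain ⟨r, hr⟩ := exists_notMem_eigZeroSet hlam
  obtain ⟨child, hchild⟩ := exists_boundary_choice hT ⟨r, hr⟩
  let mk := (T.induce (eigZeroSet T lam)ᶜ).connectedComponentMk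
  let B : Matrix (boundary T lam) (Comp T (eigZeroSet T lam)) ℝ :=
    LinearMap.toMatrix' (boundaryMap T lam x)
  have hB : ∀ a C, B a C = ∑ w ∈ T.neighborFinset (a : V),
      scaleOnComp T lam x (Pi.single C 1) w := by
    intro a C
    rw [← adjEnd_apply, ← boundaryMap_apply]
    exact LinearMap.toMatrix'_apply _ _ _
  have hzero : ∀ (C) (w : V), scaleOnComp T lam x (Pi.single C 1) w ≠ 0 →
      ∃ h : w ∉ eigZeroSet T lam, C = mk ⟨w, h⟩ := by
    intro C w hw
    have hwN : w ∉ eigZeroSet T lam := fun h => hw (scaleOnComp_of_mem x _ h)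
    refine ⟨hwN, ?_⟩
    by_contra hne
    refine hw ((scaleOnComp_of_notMem x _ ⟨w, hwN⟩).trans ?_)
    rw [Pi.single_eq_of_ne (Ne.symm hne), zero_mul]
  have hinj : Function.Injective B.vecMul := by
    refine (injective_iff_map_eq_zero B.vecMulLinear).mpr fun u hu => ?_
    refine eq_zero_of_vecMul_eq_zero B (fun a => mk (child a)) (fun a => T.dist r a) ?_ ?_ u
      (fun a => congrFun hu _)
    · intro a
      rw [hB, Finset.sum_eq_single_of_mem (child a : V) (by simpa using (hchild a).1)]
      · rw [scaleOnComp_of_notMem, Pi.single_eq_same, one_mul]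
        exact fun h => (child a).2 ((hx0 _).mp h)
      · intro w hw hne
        by_contra h0
        obtain ⟨hwN, hC⟩ := hzero _ w h0
        rcases (hchild a).2.2 a a.2.1 ⟨w, hwN⟩ (SimpleGraph.ConnectedComponent.exact hC)
          (by simpa using hw) with h | h
        · exact hne (congrArg Subtype.val h.2)
        · exact lt_irrefl _ h
    · intro a a' hne
      rw [hB] at hne
      obtain ⟨w, hw, h0⟩ := Finset.exists_ne_zero_of_sum_ne_zero hne
      obtain ⟨hwN, hC⟩ := hzero _ w h0
      rcases (hchild a).2.2 a' a'.2.1 ⟨w, hwN⟩ (SimpleGraph.ConnectedComponent.exact hC)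
        (by simpa using hw) with h | h
      · exact .inl (Subtype.ext h.1)
      · exact .inr h
  have hrank := (Matrix.vecMul_injective_iff.mp hinj).rank_matrix
  rw [← LinearMap.range_eq_top]
  apply Submodule.eq_top_of_finrank_eq
  rw [Module.finrank_fintype_fun_eq_card, ← hrank, Matrix.rank, ← Matrix.toLin'_apply',
    Matrix.toLin'_toMatrix']

/-- Rank-nullity for `boundaryMap`, whose kernel `scaleOnComp` identifies with the eigenspace. -/
lemma multiplicity_add_card_boundary (hT : T.IsTree) (hlam : IsEigenvalue T lam) :
    multiplicity T lam + Nat.card (boundary T lam) = Nat.card (Comp T (eigZeroSet T lam)) := by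
  classical
  have := Fintype.ofFinite (Comp T (eigZeroSet T lam))
  have := Fintype.ofFinite (boundary T lam)
  obtain ⟨x, hx, hx0⟩ := exists_generic_eigenvector T lam
  have h := (boundaryMap T lam x).finrank_range_add_finrank_ker
  rw [LinearMap.range_eq_top.mpr (boundaryMap_surjective hT hlam hx0), finrank_top,
    Module.finrank_fintype_fun_eq_card, Module.finrank_fintype_fun_eq_card,
    (Submodule.equivMapOfInjective _ (scaleOnComp_injective hx0) _).finrank_eq,
    map_ker_boundaryMap hT hx hx0] at h
  rw [multiplicity, Nat.card_eq_fintype_card, Nat.card_eq_fintype_card, ← h, add_comm]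

end Eigenspace

/-! ### The skeleton as a bipartite graph. -/

section SkeletonStructure

variable {V : Type*} {T : SimpleGraph V}

lemma mem_compVerts {N : Set V} {C : Comp T N} {v : V} :
    v ∈ compVerts T N C ↔ ∃ h : v ∉ N, (T.induce Nᶜ).connectedComponentMk ⟨v, h⟩ = C := by
  constructor
  · rintro ⟨w, hw, rfl⟩
    exact ⟨w.2, hw⟩
  · rintro ⟨h, hC⟩
    exact ⟨⟨v, h⟩, hC, rfl⟩

lemma notMem_compVerts_iff {N : Set V} {v : V} : (∀ C, v ∉ compVerts T N C) ↔ v ∈ N := by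
  constructor
  · intro h
    by_contra hv
    exact h _ (mem_compVerts.mpr ⟨hv, rfl⟩)
  · intro hv C hC
    exact (mem_compVerts.mp hC).1 hv

variable [Fintype V] {lam : ℝ}

lemma mem_eigAdjZeroSet_of_mem_boundary {v : V} (hv : v ∈ boundary T lam) :
    v ∈ eigAdjZeroSet T lam := by
  obtain ⟨hvN, w, hw, hvw⟩ := hv
  have hw' : ∃ x, IsEigenvector T lam x ∧ w ∉ zeroSet x := by
    by_contra! h
    exact hw h
  obtain ⟨x, hx, hxw⟩ := hw'
  exact ⟨x, hx, hvN x hx, _, w, mem_compVerts.mpr ⟨hxw, rfl⟩, hvw⟩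

/-- `eigAdjZeroSet` may also contain vertices where only some eigenvectors vanish. The contraction
absorbs these, so the uncontracted skeleton vertices are exactly the boundary. -/
lemma mem_boundary_of_mem_eigAdjZeroSet {v : V} (hvN : v ∈ eigZeroSet T lam)
    (hv : v ∈ eigAdjZeroSet T lam) : v ∈ boundary T lam := by
  obtain ⟨x, hx, -, C, w, hw, hvw⟩ := hv
  exact ⟨hvN, w, fun hwN => (mem_compVerts.mp hw).1 (hwN x hx), hvw⟩

/-- The skeleton vertex of a contracted component. -/
def compVertex (C : Comp T (eigZeroSet T lam)) : SkeletonVertex T lam :=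
  ⟨Sum.inl C, Or.inl ⟨C, rfl⟩⟩

/-- The skeleton vertex of a boundary vertex. -/
def boundaryVertex (a : boundary T lam) : SkeletonVertex T lam :=
  ⟨Sum.inr ⟨a, notMem_compVerts_iff.mpr a.2.1⟩,
    Or.inr ⟨_, rfl, mem_eigAdjZeroSet_of_mem_boundary a.2⟩⟩

lemma compVertex_injective :
    Function.Injective (compVertex : Comp T (eigZeroSet T lam) → SkeletonVertex T lam) :=
  fun _ _ h => Sum.inl_injective (congrArg Subtype.val h)

lemma boundaryVertex_injective :
    Function.Injective (boundaryVertex : boundary T lam → SkeletonVertex T lam) :=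
  fun a b h => by
    have h' : (boundaryVertex a).1 = (boundaryVertex b).1 := congrArg Subtype.val h
    have h'' := Sum.inr_injective h'
    exact Subtype.ext (congrArg (fun v => v.1) h'')

lemma contractedVertices_eq_range :
    contractedVertices T lam = Set.range compVertex := by
  ext s
  constructor
  · rintro ⟨C, hC⟩
    exact ⟨C, Subtype.ext hC.symm⟩
  · rintro ⟨C, rfl⟩
    exact ⟨C, rfl⟩

lemma compl_contractedVertices_eq_range :
    (contractedVertices T lam)ᶜ = Set.range boundaryVertex := by
  ext s
  constructor
  · intro hs
    obtain ⟨s, ⟨C, rfl⟩ | ⟨v, rfl, hv⟩⟩ := s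
    · exact absurd ⟨C, rfl⟩ hs
    · exact ⟨⟨v, mem_boundary_of_mem_eigAdjZeroSet (notMem_compVerts_iff.mp v.2) hv⟩, rfl⟩
  · rintro ⟨a, rfl⟩ ⟨C, hC⟩
    exact absurd hC Sum.inr_ne_inl

lemma skeleton_adj_boundaryVertex_compVertex {a : boundary T lam}
    {C : Comp T (eigZeroSet T lam)} :
    (skeleton T lam).Adj (boundaryVertex a) (compVertex C) ↔
      ∃ v : ((eigZeroSet T lam)ᶜ : Set V),
        (T.induce (eigZeroSet T lam)ᶜ).connectedComponentMk v = C ∧ T.Adj a v := by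
  constructor
  · rintro ⟨-, u, hu, v, hv, huv⟩
    obtain ⟨hvN, hC⟩ := mem_compVerts.mp hv
    have hua : u = a := hu
    exact ⟨⟨v, hvN⟩, hC, hua ▸ huv⟩
  · rintro ⟨v, hC, hav⟩
    exact ⟨Sum.inr_ne_inl, a, rfl, v, mem_compVerts.mpr ⟨v.2, hC⟩, hav⟩

lemma not_skeleton_adj_compVertex (C C' : Comp T (eigZeroSet T lam)) :
    ¬ (skeleton T lam).Adj (compVertex C) (compVertex C') := by
  rintro ⟨hne, u, hu, v, hv, huv⟩
  obtain ⟨huN, rfl⟩ := mem_compVerts.mp hu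
  obtain ⟨hvN, rfl⟩ := mem_compVerts.mp hv
  have hadj : (T.induce (eigZeroSet T lam)ᶜ).Adj ⟨u, huN⟩ ⟨v, hvN⟩ := huv
  exact hne (congrArg Sum.inl (SimpleGraph.ConnectedComponent.sound hadj.reachable))

lemma not_skeleton_adj_of_mem_contractedVertices (c) (hc : c ∈ contractedVertices T lam) (c')
    (hc' : c' ∈ contractedVertices T lam) : ¬ (skeleton T lam).Adj c c' := by
  rw [contractedVertices_eq_range] at hc hc'
  obtain ⟨C, rfl⟩ := hc
  obtain ⟨C', rfl⟩ := hc'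
  exact not_skeleton_adj_compVertex C C'

/-- A choice of an adjacent component for each boundary vertex, avoiding a given component, with
respect to which the boundary vertices can be ordered. -/
lemma exists_component_choice (hT : T.IsTree) (C₀ : Comp T (eigZeroSet T lam)) :
    ∃ (κ : boundary T lam → Comp T (eigZeroSet T lam)) (d : boundary T lam → ℕ),
      Function.Injective κ ∧ (∀ a, κ a ≠ C₀) ∧
      (∀ a, (skeleton T lam).Adj (boundaryVertex a) (compVertex (κ a))) ∧
      ∀ a a', (skeleton T lam).Adj (boundaryVertex a') (compVertex (κ a)) →
        a' = a ∨ d a < d a' := by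
  induction C₀ using SimpleGraph.ConnectedComponent.ind with
  | _ r =>
    obtain ⟨child, hchild⟩ := exists_boundary_choice hT r
    have hadj : ∀ a, (skeleton T lam).Adj (boundaryVertex a)
        (compVertex ((T.induce (eigZeroSet T lam)ᶜ).connectedComponentMk (child a))) :=
      fun a => skeleton_adj_boundaryVertex_compVertex.mpr ⟨child a, rfl, (hchild a).1⟩
    have htri : ∀ a a', (skeleton T lam).Adj (boundaryVertex a')
        (compVertex ((T.induce (eigZeroSet T lam)ᶜ).connectedComponentMk (child a))) →
        a' = a ∨ T.dist r a < T.dist r a' := by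
      intro a a' h
      obtain ⟨v, hv, hav⟩ := skeleton_adj_boundaryVertex_compVertex.mp h
      rcases (hchild a).2.2 a' a'.2.1 v (SimpleGraph.ConnectedComponent.exact hv.symm) hav
        with h | h
      · exact .inl (Subtype.ext h.1)
      · exact .inr h
    -- Injectivity: two distinct boundary vertices with the same chosen component would each be
    -- deeper than the other.
    refine ⟨_, fun a => T.dist r a, fun a a' h => ?_, fun a h => ?_, hadj, htri⟩
    · rcases htri a a' (h ▸ hadj a') with h1 | h1
      · exact h1.symm
      · rcases htri a' a (h ▸ hadj a) with h2 | h2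
        · exact h2
        · omega
    · exact (hchild a).2.1 (SimpleGraph.ConnectedComponent.exact h)

lemma exists_matching_choice (hT : T.IsTree) (c : contractedVertices T lam) :
    ∃ κ : ((contractedVertices T lam)ᶜ : Set _) → contractedVertices T lam,
      Function.Injective κ ∧
      (∀ a : ((contractedVertices T lam)ᶜ : Set _), (skeleton T lam).Adj a (κ a)) ∧
      ∀ a, κ a ≠ c := by
  obtain ⟨c, C₀, hC₀⟩ := c
  obtain ⟨κ, d, hinj, hne, hadj, -⟩ := exists_component_choice hT C₀
  have hsurj : ∀ s : ((contractedVertices T lam)ᶜ : Set _), ∃ a, boundaryVertex a = s.1 :=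
    fun s => compl_contractedVertices_eq_range.subset s.2
  choose g hg using hsurj
  refine ⟨fun s => ⟨compVertex (κ (g s)), κ (g s), rfl⟩, fun s t h => ?_, fun s => ?_,
    fun s h => hne (g s) ?_⟩
  · have h' := hinj (compVertex_injective (congrArg Subtype.val h))
    exact Subtype.ext (by rw [← hg, ← hg, h'])
  · have := hadj (g s)
    rwa [hg] at this
  · exact Sum.inl_injective ((congrArg Subtype.val (congrArg Subtype.val h)).trans hC₀)

lemma ncard_contractedVertices :
    (contractedVertices T lam).ncard = Nat.card (Comp T (eigZeroSet T lam)) := by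
  rw [contractedVertices_eq_range, ← Set.image_univ,
    Set.ncard_image_of_injective _ compVertex_injective, Set.ncard_univ]

lemma ncard_compl_contractedVertices :
    ((contractedVertices T lam)ᶜ).ncard = Nat.card (boundary T lam) := by
  rw [compl_contractedVertices_eq_range, ← Set.image_univ,
    Set.ncard_image_of_injective _ boundaryVertex_injective, Set.ncard_univ]

/-- A null vector of the skeleton vanishes on the boundary vertices. -/
lemma nullSpace_apply_boundaryVertex (hT : T.IsTree) (C₀ : Comp T (eigZeroSet T lam))
    {y : SkeletonVertex T lam → ℝ} (hy : y ∈ nullSpace (skeleton T lam)) (a : boundary T lam) :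
    y (boundaryVertex a) = 0 := by
  classical
  obtain ⟨κ, d, -, -, hadj, htri⟩ := exists_component_choice hT C₀
  let B : boundary T lam → Comp T (eigZeroSet T lam) → ℝ := fun a C =>
    if (skeleton T lam).Adj (boundaryVertex a) (compVertex C) then 1 else 0
  refine congrFun (eq_zero_of_vecMul_eq_zero B κ d (fun a => ?_) (fun a a' h => htri a a' ?_)
    (fun a => y (boundaryVertex a)) fun a => ?_) a
  · simp [B, hadj a]
  · by_contra h'
    exact h (if_neg h')
  -- All neighbours of a contracted component are boundary vertices, so the null equation there is
  -- column `κ a` of the system.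
  · have h : adjEnd (skeleton T lam) y (compVertex (κ a)) = 0 :=
      congrFun (LinearMap.mem_ker.mp hy) _
    rw [adjEnd_apply, SimpleGraph.neighborFinset_eq_filter, Finset.sum_filter] at h
    rw [← h]
    refine Fintype.sum_of_injective boundaryVertex boundaryVertex_injective _ _ ?_ fun a' => ?_
    · intro s hs
      rw [← compl_contractedVertices_eq_range, Set.mem_compl_iff, not_not] at hs
      exact if_neg (not_skeleton_adj_of_mem_contractedVertices _ ⟨_, rfl⟩ _ hs)
    · simp only [B, mul_ite, mul_one, mul_zero, SimpleGraph.adj_comm]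

end SkeletonStructure

end TreeSkeleton

theorem mainTheorem1 {V : Type*} [Fintype V] (T : SimpleGraph V) (hT : T.IsTree)
    (lam : ℝ) (hlam : TreeSkeleton.IsEigenvalue T lam) :
    {s : TreeSkeleton.SkeletonVertex T lam |
        ∃ M : (TreeSkeleton.skeleton T lam).Subgraph,
          TreeSkeleton.IsMaximumMatching M ∧ s ∉ M.verts} =
      TreeSkeleton.contractedVertices T lam ∧
    (∀ M : (TreeSkeleton.skeleton T lam).Subgraph, TreeSkeleton.IsMaximumMatching M →
      {s : TreeSkeleton.SkeletonVertex T lam | s ∉ M.verts}.ncard =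
        TreeSkeleton.multiplicity T lam) ∧
    (∀ y ∈ TreeSkeleton.nullSpace (TreeSkeleton.skeleton T lam),
      ∀ s : TreeSkeleton.SkeletonVertex T lam, y s ≠ 0 →
        s ∈ TreeSkeleton.contractedVertices T lam) := by

  obtain ⟨r, hr⟩ := TreeSkeleton.exists_notMem_eigZeroSet hlam
  let C₀ : TreeSkeleton.Comp T (TreeSkeleton.eigZeroSet T lam) :=
    SimpleGraph.connectedComponentMk _ ⟨r, hr⟩
  refine ⟨?_, fun M hM => ?_, fun y hy s hs => ?_⟩
  · exact TreeSkeleton.missed_eq_of_forall_exists ⟨TreeSkeleton.compVertex C₀, C₀, rfl⟩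
      TreeSkeleton.not_skeleton_adj_of_mem_contractedVertices
      (TreeSkeleton.exists_matching_choice hT)
  · obtain ⟨κ, hinj, hadj, -⟩ :=
      TreeSkeleton.exists_matching_choice hT ⟨TreeSkeleton.compVertex C₀, C₀, rfl⟩
    have h := (TreeSkeleton.compl_subset_verts_of_isMaximumMatching
      TreeSkeleton.not_skeleton_adj_of_mem_contractedVertices hinj hadj hM).2
    have hmul := TreeSkeleton.multiplicity_add_card_boundary hT hlam
    rw [TreeSkeleton.ncard_contractedVertices, TreeSkeleton.ncard_compl_contractedVertices] at h
    omega
  · by_contra hsK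
    have hs' : s ∈ Set.range TreeSkeleton.boundaryVertex :=
      TreeSkeleton.compl_contractedVertices_eq_range.subset hsK
    obtain ⟨a, rfl⟩ := hs'
    exact hs (TreeSkeleton.nullSpace_apply_boundaryVertex hT C₀ hy a)
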